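/- A piecewise Euclidean CW complex is a (Hausdorff) CW complex $Y$ in which every $n$-cell has a characteristic map defined on a compact convex polytope in $\mathbb{R}^n$ with non-empty interior, such that the polytopes are glued along their boundaries by isometries: whenever a point $x$ of the polytope of a cell $\sigma$ is mapped into the open cell $\tau$, the polytope of $\sigma$ contains an isometric copy of the polytope of $\tau$ that has $x$ in its relative interior and on which the two characteristic maps agree. The distance of two points of $Y$ is the infimum of the lengths of broken geodesics between them, that is, of finite sequences of segments each lying in a single cell ($\infty$ if there are none). Let $\mathbb{E}$ be a finite-dimensional Euclidean vector space, $\Lambda$ a finite set of linear forms on $\mathbb{E}$, $Y$ a piecewise Euclidean CW complex, and $\pi : Y \to \mathbb{E}$ a map. The pair $(Y,\pi)$ is called a $\Lambda$-complex if there is a non-empty, finite or infinite, sequence $E_0, E_1, E_2, \dots$ of subcomplexes of $Y$ such that 1. for every $j$, $\pi$ restricts to an isometry of $E_j$ onto $\mathbb{E}$ (a homeomorphism that preserves distances); 2. $Y = \bigcup_{j} E_j$; 3. for every $j > 0$, the set $E_j \setminus \bigcup_{i<j} E_i$ is the interior, relative to $E_j$, of a subcomplex of $E_j$ whose image under $\pi$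 is of the form $\{ e \in \mathbb{E} \mid \lambda(e) \le c_\lambda \text{ for all } \lambda \in \Lambda \}$ with constants $c_\lambda \in \mathbb{R} \cup \{\infty\}$ that are not all $\infty$ (they may depend on $j$). For an integer $m \ge 0$, the set $\Lambda$ is called $m$-tame if $0$ does not lie in the convex hull of any set of at most $m$ elements of $\Lambda$. **Proposition 4.11.** Let $(Y, \pi : Y \to \mathbb{E})$ be a $\Lambda$-complex and suppose that $\Lambda$ is $m$-tame. Then $Y$ is $(m-1)$-connected, that is, $Y$ is non-empty and $\pi_k(Y, y)$ is trivial for every $y \in Y$ and every $0 \le k \le m-1$. -/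

import Mathlib

open Topology Set

/-- A piecewise Euclidean structure on a CW complex `Y`: every cell is parametrised by a compact
convex Euclidean polytope with non-empty interior, and the polytopes are glued along their
boundaries by isometries. -/
structure PiecewiseEuclidean (Y : Type*) [TopologicalSpace Y] [CWComplex (univ : Set Y)] where
  /-- Finitely many points spanning the polytope of a cell. -/
  vertices (n : ℕ) (i : RelCWComplex.cell (univ : Set Y) n) : Finset (EuclideanSpace ℝ (Fin n))
  /-- The characteristic map of a cell; only its values on the polytope matter. -/
  chart (n : ℕ) (i : RelCWComplex.cell (univ : Set Y) n) : EuclideanSpace ℝ (Fin n) → Y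
  interior_nonempty (n : ℕ) (i : RelCWComplex.cell (univ : Set Y) n) :
    (interior (convexHull ℝ (vertices n i : Set (EuclideanSpace ℝ (Fin n))))).Nonempty
  continuousOn (n : ℕ) (i : RelCWComplex.cell (univ : Set Y) n) :
    ContinuousOn (chart n i) (convexHull ℝ (vertices n i : Set (EuclideanSpace ℝ (Fin n))))
  injOn (n : ℕ) (i : RelCWComplex.cell (univ : Set Y) n) :
    InjOn (chart n i)
      (interior (convexHull ℝ (vertices n i : Set (EuclideanSpace ℝ (Fin n)))))
  image_interior (n : ℕ) (i : RelCWComplex.cell (univ : Set Y) n) :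
    chart n i '' interior (convexHull ℝ (vertices n i : Set (EuclideanSpace ℝ (Fin n)))) =
      RelCWComplex.openCell n i
  image_polytope (n : ℕ) (i : RelCWComplex.cell (univ : Set Y) n) :
    chart n i '' convexHull ℝ (vertices n i : Set (EuclideanSpace ℝ (Fin n))) =
      RelCWComplex.closedCell n i
  /-- If a point `x` of the polytope of the cell `(n, i)` is mapped into the open cell `(k, j)`,
  then `x` is an interior point of an isometric copy of the polytope of `(k, j)` inside the
  polytope of `(n, i)`, on which the two characteristic maps agree. -/
  glue (n : ℕ) (i : RelCWComplex.cell (univ : Set Y) n)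
    (k : ℕ) (j : RelCWComplex.cell (univ : Set Y) k)
    (x : EuclideanSpace ℝ (Fin n))
    (hx : x ∈ convexHull ℝ (vertices n i : Set (EuclideanSpace ℝ (Fin n))))
    (hxj : chart n i x ∈ RelCWComplex.openCell (C := (univ : Set Y)) k j) :
    ∃ f : EuclideanSpace ℝ (Fin k) →ᵃⁱ[ℝ] EuclideanSpace ℝ (Fin n),
      x ∈ f '' interior (convexHull ℝ (vertices k j : Set (EuclideanSpace ℝ (Fin k)))) ∧
      ∀ z ∈ convexHull ℝ (vertices k j : Set (EuclideanSpace ℝ (Fin k))),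
        f z ∈ convexHull ℝ (vertices n i : Set (EuclideanSpace ℝ (Fin n))) ∧
        chart n i (f z) = chart k j z

namespace PiecewiseEuclidean

variable {Y : Type*} [TopologicalSpace Y] [CWComplex (univ : Set Y)]

/-- The polytope that parametrises a cell. -/
def polytope (D : PiecewiseEuclidean Y) (n : ℕ) (i : RelCWComplex.cell (univ : Set Y) n) :
    Set (EuclideanSpace ℝ (Fin n)) :=
  convexHull ℝ (D.vertices n i : Set (EuclideanSpace ℝ (Fin n)))

/-- `D.Joined x y l`: there is a broken geodesic of length `l` from `x` to `y`, that is, a finite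
sequence of straight segments, each inside the polytope of one cell. -/
inductive Joined (D : PiecewiseEuclidean Y) : Y → Y → ℝ → Prop
  | refl (x : Y) : Joined D x x 0
  | step {n : ℕ} {i : RelCWComplex.cell (univ : Set Y) n} {p q : EuclideanSpace ℝ (Fin n)}
      {z : Y} {l : ℝ} (hp : p ∈ D.polytope n i) (hq : q ∈ D.polytope n i)
      (h : Joined D (D.chart n i q) z l) : Joined D (D.chart n i p) z (dist p q + l)

/-- The piecewise Euclidean (length) metric: the infimum of the lengths of broken geodesics,
and `∞` if there is none. -/
noncomputable def lengthDist (D : PiecewiseEuclidean Y) (x y : Y) : ENNReal :=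
  ⨅ (l : ℝ) (_ : D.Joined x y l), ENNReal.ofReal l

end PiecewiseEuclidean

/-- `p` restricts on `S` to an isometry onto the Euclidean space `V`: it is a homeomorphism onto
`V` and carries the piecewise Euclidean metric to the metric of `V`. -/
structure IsIsometryOnto {Y : Type*} [TopologicalSpace Y] [CWComplex (univ : Set Y)]
    (D : PiecewiseEuclidean Y) {V : Type*} [NormedAddCommGroup V] (p : Y → V) (S : Set Y) :
    Prop where
  isHomeomorph : IsHomeomorph (fun y : S ↦ p y)
  isometry : ∀ x ∈ S, ∀ y ∈ S, edist (p x) (p y) = D.lengthDist x y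

/-- `E j`, for `j < N` (where `N` is a positive integer or `∞`), is an increasing sequence of
subcomplexes for `p : Y → V` and the set `Λ` of linear forms. -/
structure IsIncreasingSequence {Y : Type*} [TopologicalSpace Y] [CWComplex (univ : Set Y)]
    (D : PiecewiseEuclidean Y) {V : Type*} [NormedAddCommGroup V] [InnerProductSpace ℝ V]
    (p : Y → V) (Λ : Set (Module.Dual ℝ V)) (N : ℕ∞)
    (E : ℕ → RelCWComplex.Subcomplex (univ : Set Y)) : Prop where
  pos : 0 < N
  isometry : ∀ j : ℕ, (j : ℕ∞) < N → IsIsometryOnto D p (E j : Set Y)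
  cover : ∀ y : Y, ∃ j : ℕ, (j : ℕ∞) < N ∧ y ∈ E j
  /-- The new part is the interior, relative to `E j`, of a subcomplex `K` of `E j` whose image
  is cut out by the inequalities `lam e ≤ c lam`, not all of which are void. -/
  newPart : ∀ j : ℕ, 0 < j → (j : ℕ∞) < N →
    ∃ (K : RelCWComplex.Subcomplex (univ : Set Y)) (c : Module.Dual ℝ V → WithTop ℝ),
      (K : Set Y) ⊆ E j ∧
      (∃ lam ∈ Λ, c lam ≠ ⊤) ∧
      p '' (K : Set Y) = {e : V | ∀ lam ∈ Λ, ((lam e : ℝ) : WithTop ℝ) ≤ c lam} ∧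
      (E j : Set Y) \ ⋃ i < j, (E i : Set Y) =
        Subtype.val '' interior {y : (E j : Set Y) | (y : Y) ∈ (K : Set Y)}

/-- `(Y, p)` is a `Λ`-complex. -/
def IsLambdaComplex {Y : Type*} [TopologicalSpace Y] [CWComplex (univ : Set Y)]
    (D : PiecewiseEuclidean Y) {V : Type*} [NormedAddCommGroup V] [InnerProductSpace ℝ V]
    (p : Y → V) (Λ : Set (Module.Dual ℝ V)) : Prop :=
  Λ.Finite ∧ ∃ (N : ℕ∞) (E : ℕ → RelCWComplex.Subcomplex (univ : Set Y)),
    IsIncreasingSequence D p Λ N E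

/-- `Λ` is `m`-tame: `0` is not in the convex hull of at most `m` elements of `Λ`. -/
def IsTame {V : Type*} [AddCommGroup V] [Module ℝ V] (m : ℕ) (Λ : Set (Module.Dual ℝ V)) : Prop :=
  ∀ T : Finset (Module.Dual ℝ V), (T : Set (Module.Dual ℝ V)) ⊆ Λ → T.card ≤ m →
    (0 : Module.Dual ℝ V) ∉ convexHull ℝ (T : Set (Module.Dual ℝ V))

/-- `Y` is `n`-connected (`n ≥ -1`): it is non-empty and its homotopy sets and groups vanish, for
every base point, in all degrees up to `n`. -/
def IsNConnected (n : ℤ) (Y : Type*) [TopologicalSpace Y] : Prop :=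
  Nonempty Y ∧ ∀ k : ℕ, (k : ℤ) ≤ n → ∀ y : Y, Subsingleton (HomotopyGroup.Pi k Y y)

/-! A map of a `k`-sphere into `Y` has compact image, so it lands in finitely many members of the
sequence (`CWComplex.isCompact_subset_iUnion_subcomplex`). For `k < m` it can be pushed out of the
last one into the earlier ones, and so by induction into `E 0`, which is homeomorphic to `V` and
hence contractible.

The pushing step is `IsTame.exists_homotopic`. The new part of `E j` is an open polyhedron `P` given
by finitely many strict inequalities `l < c l`, and radial projection from a point `x₁` of `P` moves
the map out of `P` as long as the map avoids the cone of points `x₁ + v` with `l v ≤ 0` for all `l`.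
There are two ways to achieve this. If the recession cone is not a linear subspace, compactness lets
`x₁` be moved so far along it that the map avoids the cone. If it is a subspace `C`, then `0` is a
convex combination of the forms (Gordan), so Carathéodory and tameness give `Cᗮ` dimension at least
`m > k`. A small perturbation of the `Cᗮ`-component then misses a point, which serves as `x₁`. -/

/-! ### Compact subsets of CW complexes -/

/-- If every open cell of a CW complex lies in a member of an increasing sequence of sets, then so
does every closed cell. -/
theorem Topology.CWComplex.closedCell_subset_of_monotone {Y : Type*} [TopologicalSpace Y] [T2Space Y]
    [CWComplex (univ : Set Y)] {Z : ℕ → Set Y} (hmono : Monotone Z)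
    (hZ : ∀ n (i : RelCWComplex.cell (univ : Set Y) n), ∃ J,
      RelCWComplex.openCell (C := (univ : Set Y)) n i ⊆ Z J) :
    ∀ n (i : RelCWComplex.cell (univ : Set Y) n), ∃ J,
      RelCWComplex.closedCell (C := (univ : Set Y)) n i ⊆ Z J := by
  intro n
  induction n using Nat.strong_induction_on with
  | _ n ih =>
    intro i
    obtain ⟨I, hI⟩ := CWComplex.cellFrontier_subset_finite_closedCell (C := (univ : Set Y)) n i
    choose b hb using ih
    obtain ⟨J₀, hJ₀⟩ := hZ n i
    -- The frontier meets only finitely many closed cells of lower dimension; `B` bounds their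
    -- indices. The value `0` for `m ≥ n` is never used.
    let B : ℕ := (Finset.range n).sup fun m ↦ (I m).sup fun j ↦
      if h : m < n then b m h j else 0
    refine ⟨J₀ ⊔ B, ?_⟩
    rw [← RelCWComplex.cellFrontier_union_openCell_eq_closedCell]
    refine union_subset (hI.trans ?_) (hJ₀.trans (hmono le_sup_left))
    refine iUnion₂_subset fun m hm ↦ iUnion₂_subset fun j hj ↦ ?_
    refine (hb m hm j).trans (hmono (le_sup_of_le_right ?_))
    calc b m hm j = (fun j ↦ if h : m < n then b m h j else 0) j := by simp [hm]
      _ ≤ (I m).sup fun j ↦ if h : m < n then b m h j else 0 :=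
        Finset.le_sup (f := fun j ↦ if h : m < n then b m h j else 0) hj
      _ ≤ B := Finset.le_sup (f := fun m ↦ (I m).sup fun j ↦ if h : m < n then b m h j else 0)
        (Finset.mem_range.2 hm)

/-- If an increasing sequence of sets exhausts a CW complex in such a way that every open cell lies
in one of them, then so does every compact set. -/
theorem Topology.CWComplex.isCompact_subset_of_monotone {Y : Type*} [TopologicalSpace Y] [T2Space Y]
    [CWComplex (univ : Set Y)] {Z : ℕ → Set Y} (hmono : Monotone Z)
    (hZ : ∀ n (i : RelCWComplex.cell (univ : Set Y) n), ∃ J,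
      RelCWComplex.openCell (C := (univ : Set Y)) n i ⊆ Z J)
    {K : Set Y} (hK : IsCompact K) : ∃ J, K ⊆ Z J := by
  have hcl := CWComplex.closedCell_subset_of_monotone hmono hZ
  by_contra! hne
  have hx : ∀ J, ∃ x ∈ K, x ∉ Z J := fun J ↦ not_subset.1 (hne J)
  choose x hxK hxZ using hx
  -- The tails of the sequence `x` meet every closed cell in a finite set, hence are closed. By
  -- compactness they have a common point; it lies in a closed cell inside some `Z L`, yet equals
  -- some `x l` with `l ≥ L`.
  let A : ℕ → Set Y := fun J ↦ x '' Ici J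
  have hA : ∀ J, IsClosed (A J) := by
    intro J
    rw [CWComplex.closed univ _ (subset_univ _)]
    intro n i
    obtain ⟨L, hL⟩ := hcl n i
    refine Set.Finite.isClosed (((finite_Iio L).image x).subset ?_)
    rintro _ ⟨⟨l, -, rfl⟩, h⟩
    refine mem_image_of_mem _ (lt_of_not_ge fun hl ↦ hxZ l (hmono hl (hL h)))
  have hAK : ∀ J, A J ⊆ K := by
    rintro J _ ⟨l, -, rfl⟩
    exact hxK l
  obtain ⟨y, hy⟩ := IsCompact.nonempty_iInter_of_sequence_nonempty_isCompact_isClosed A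
    (fun J ↦ image_mono (Ici_subset_Ici.2 J.le_succ)) (fun J ↦ ⟨x J, J, self_mem_Ici, rfl⟩)
    (hK.of_isClosed_subset (hA 0) (hAK 0)) hA
  have hyu : y ∈ ⋃ (n : ℕ) (j : RelCWComplex.cell (univ : Set Y) n),
      RelCWComplex.closedCell n j := by
    rw [CWComplex.union]; trivial
  simp only [mem_iUnion] at hyu
  obtain ⟨n, i, hyi⟩ := hyu
  obtain ⟨L, hL⟩ := hcl n i
  obtain ⟨l, hl, hly⟩ := mem_iInter.1 hy L
  exact hxZ l (hmono hl (hL (hly ▸ hyi)))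

/-- A compact subset of a CW complex that is the union of a sequence of subcomplexes lies in
finitely many of them. -/
theorem Topology.CWComplex.isCompact_subset_iUnion_subcomplex {Y : Type*} [TopologicalSpace Y]
    [T2Space Y] [CWComplex (univ : Set Y)] {P : ℕ → Prop}
    {E : ℕ → RelCWComplex.Subcomplex (univ : Set Y)} (hE : ∀ y, ∃ j, P j ∧ y ∈ E j)
    {K : Set Y} (hK : IsCompact K) : ∃ J, ∀ y ∈ K, ∃ i ≤ J, P i ∧ y ∈ E i := by
  refine CWComplex.isCompact_subset_of_monotone (Z := fun J ↦ {y | ∃ i ≤ J, P i ∧ y ∈ E i})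
    (fun J L h y ⟨i, hi, hy⟩ ↦ ⟨i, hi.trans h, hy⟩) (fun n i ↦ ?_) hK
  obtain ⟨y, hy⟩ := RelCWComplex.openCell_nonempty (C := (univ : Set Y)) n i
  obtain ⟨j, hj, hyj⟩ := hE y
  have hi : i ∈ (E j).I n := by
    by_contra h
    exact disjoint_left.1 (RelCWComplex.Subcomplex.disjoint_openCell_subcomplex_of_not_mem _ h) hy hyj
  exact ⟨j, fun z hz ↦ ⟨j, le_rfl, hj, RelCWComplex.Subcomplex.openCell_subset_of_mem _ hi hz⟩⟩

/-! ### Nullhomotopic maps on cubical spheres and homotopy groups -/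

open scoped unitInterval

theorem Pi.exists_norm_apply_eq_norm {ι : Type*} [Fintype ι] [Nonempty ι] (x : ι → ℝ) :
    ∃ i, ‖x i‖ = ‖x‖ := by
  obtain ⟨i, -, hi⟩ := Finset.exists_mem_eq_sup Finset.univ Finset.univ_nonempty fun i ↦ ‖x i‖₊
  exact ⟨i, congrArg NNReal.toReal hi.symm⟩

/-- A nullhomotopic map on the unit sphere of a normed space extends to the whole space. -/
theorem ContinuousMap.Nullhomotopic.exists_extend_sphere {E : Type*} [NormedAddCommGroup E]
    [NormedSpace ℝ E] {Y : Type*} [TopologicalSpace Y] {f : C(Metric.sphere (0 : E) 1, Y)}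
    (hf : f.Nullhomotopic) : ∃ F : C(E, Y), ∀ x : Metric.sphere (0 : E) 1, F x = f x := by
  classical
  obtain ⟨y, ⟨H⟩⟩ := hf
  let u : {x : E // x ≠ 0} → Metric.sphere (0 : E) 1 := fun x ↦
    ⟨‖(x : E)‖⁻¹ • (x : E), by simp [norm_smul, norm_ne_zero_iff.2 x.2]⟩
  have hu : Continuous u := by
    refine Continuous.subtype_mk (Continuous.smul (Continuous.inv₀ (by fun_prop) fun x ↦ ?_)
      (by fun_prop)) _
    exact norm_ne_zero_iff.2 x.2
  -- The time is `0` for `‖x‖ ≥ 1` and `1` for `‖x‖ ≤ 1/2`, so `F` is constant near the origin,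
  -- where the direction `u` is undefined.
  let τ : E → I := fun x ↦ projIcc 0 1 zero_le_one (2 * (1 - ‖x‖))
  have hτ : Continuous τ := continuous_projIcc.comp (by fun_prop)
  let F : E → Y := fun x ↦ if h : x = 0 then y else H (τ x, u ⟨x, h⟩)
  have hF : Continuous F := by
    rw [continuous_iff_continuousAt]
    intro x
    rcases eq_or_ne x 0 with rfl | hx
    · have : F =ᶠ[𝓝 0] fun _ ↦ y := by
        filter_upwards [Metric.ball_mem_nhds (0 : E) (one_half_pos)] with z hz
        by_cases h : z = 0
        · simp [F, h]
        · have : τ z = 1 := projIcc_of_right_le _ (by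
            rw [mem_ball_zero_iff] at hz; linarith)
          simp [F, h, this]
      exact continuousAt_const.congr this.symm
    · have ho : IsOpen {x : E | x ≠ 0} := isOpen_ne
      refine ContinuousOn.continuousAt (s := {x : E | x ≠ 0}) ?_ (ho.mem_nhds hx)
      rw [continuousOn_iff_continuous_domRestrict]
      have : Continuous fun x : {x : E // x ≠ 0} ↦ H (τ x, u x) := by fun_prop
      refine this.congr fun x ↦ ?_
      change _ = F (x : E)
      simp only [F, dif_neg x.2]
  refine ⟨⟨F, hF⟩, fun x ↦ ?_⟩
  have hx1 : ‖(x : E)‖ = 1 := by simp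
  have hx : (x : E) ≠ 0 := by
    rw [← norm_ne_zero_iff, hx1]; exact one_ne_zero
  have h0 : τ x = 0 := projIcc_of_le_left _ (by rw [hx1]; norm_num)
  have hux : u ⟨x, hx⟩ = x := Subtype.ext (by simp [u, hx1])
  simp [F, hx, h0, hux]

/-- If every map of the `k`-sphere (modelled by the boundary of a cube) to `Y` is nullhomotopic,
then `π_k` vanishes at every base point. -/
theorem HomotopyGroup.subsingleton_pi_of_nullhomotopic {Y : Type*} [TopologicalSpace Y] {k : ℕ}
    (h : ∀ f : C(Metric.sphere (0 : Fin (k + 1) → ℝ) 1, Y), f.Nullhomotopic) (y : Y) :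
    Subsingleton (HomotopyGroup.Pi k Y y) := by
  suffices key : ∀ f g : GenLoop (Fin k) Y y, GenLoop.Homotopic f g by
    refine ⟨fun a b ↦ ?_⟩
    induction a using Quotient.inductionOn
    induction b using Quotient.inductionOn
    exact Quotient.sound (key _ _)
  intro f g
  let c : (Fin (k + 1) → ℝ) → (Fin k → I) := fun x i ↦
    projIcc 0 1 zero_le_one ((x i.succ + 1) / 2)
  have hc : Continuous c := continuous_pi fun i ↦ continuous_projIcc.comp (by fun_prop)
  have hbd : ∀ x : Fin (k + 1) → ℝ, ∀ i : Fin k, |x i.succ| = 1 → c x ∈ Cube.boundary (Fin k) := by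
    intro x i hi
    refine ⟨i, ?_⟩
    rcases (abs_eq zero_le_one).1 hi with hi | hi
    · right; exact projIcc_of_right_le _ (by rw [hi]; norm_num)
    · left; exact projIcc_of_le_left _ (by rw [hi]; norm_num)
  -- Glue `f` on the lower half of the cube's boundary to `g` on the upper half. Where coordinate
  -- `0` vanishes, some other coordinate is `±1`, so both loops take the base point as value.
  have hΦ : Continuous fun x : Metric.sphere (0 : Fin (k + 1) → ℝ) 1 ↦
      if (x : Fin (k + 1) → ℝ) 0 ≤ 0 then f (c x) else g (c x) := by
    refine Continuous.if_le ?_ ?_ ?_ continuous_const ?_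
    · exact f.1.continuous.comp (hc.comp continuous_subtype_val)
    · exact g.1.continuous.comp (hc.comp continuous_subtype_val)
    · exact (continuous_apply 0).comp continuous_subtype_val
    · intro x hx
      have hx1 : ‖(x : Fin (k + 1) → ℝ)‖ = 1 := by simp
      obtain ⟨i, hi⟩ := Pi.exists_norm_apply_eq_norm (x : Fin (k + 1) → ℝ)
      rw [hx1, Real.norm_eq_abs] at hi
      refine Fin.cases (fun hi ↦ ?_) (fun i hi ↦ ?_) i hi
      · rw [hx] at hi; simp at hi
      · exact (f.2 _ (hbd _ i hi)).trans (g.2 _ (hbd _ i hi)).symm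
  obtain ⟨F, hF⟩ := (h ⟨_, hΦ⟩).exists_extend_sphere
  -- Rescaled to `[-1, 1]`, the filled cube is itself the homotopy: coordinate `0` is time, the
  -- bottom face carries `f`, the top face `g`, and the side faces the base point.
  let e : I × (Fin k → I) → (Fin (k + 1) → ℝ) := fun z ↦
    Fin.cons (2 * (z.1 : ℝ) - 1) fun i ↦ 2 * (z.2 i : ℝ) - 1
  have he : Continuous e := by
    refine continuous_pi fun i ↦ ?_
    refine Fin.cases ?_ (fun i ↦ ?_) i
    · simp only [e, Fin.cons_zero]; fun_prop
    · simp only [e, Fin.cons_succ]; fun_prop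
  have hce : ∀ z, c (e z) = z.2 := by
    intro z; ext i
    simp only [c, e, Fin.cons_succ]
    rw [show (2 * (z.2 i : ℝ) - 1 + 1) / 2 = z.2 i by ring, projIcc_val]
  have hle : ∀ s : I, |2 * (s : ℝ) - 1| ≤ 1 := fun s ↦ by
    rw [abs_le]; constructor <;> linarith [s.2.1, s.2.2]
  have hmem : ∀ z i, |e z i| = 1 → ‖e z‖ = 1 := by
    intro z i hi
    refine le_antisymm ((pi_norm_le_iff_of_nonneg zero_le_one).2 fun j ↦ ?_) ?_
    · refine Fin.cases ?_ (fun j ↦ ?_) j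
      · simpa [e] using hle z.1
      · simpa [e] using hle (z.2 j)
    · rw [← hi, ← Real.norm_eq_abs]; exact norm_le_pi_norm _ i
  have hFe : ∀ z, ‖e z‖ = 1 → F (e z) = if e z 0 ≤ 0 then f z.2 else g z.2 := by
    intro z hz
    have := hF ⟨e z, by simpa using hz⟩
    simpa [hce] using this
  refine ⟨⟨⟨⟨fun z ↦ F (e z), F.continuous.comp he⟩, fun x ↦ ?_, fun x ↦ ?_⟩, ?_⟩⟩
  · change F (e (0, x)) = f x
    rw [hFe _ (hmem _ 0 (by simp [e]))]
    simp [e]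
  · change F (e (1, x)) = g x
    rw [hFe _ (hmem _ 0 (by norm_num [e]))]
    norm_num [e]
  · rintro t x ⟨i, hi⟩
    change F (e (t, x)) = f x
    have hx : x ∈ Cube.boundary (Fin k) := ⟨i, hi⟩
    rw [hFe _ (hmem _ i.succ (by rcases hi with hi | hi <;> simp [e, hi]; norm_num))]
    have hfg : f x = g x := (f.2 _ hx).trans (g.2 _ hx).symm
    change (if _ then f x else g x) = f x
    rw [hfg, ite_self]

/-! ### Maps from spheres to spaces of larger dimension -/

/-- The boundary of the `n + 1`-dimensional cube has Hausdorff dimension at most `n`. -/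
theorem dimH_sphere_pi_le (n : ℕ) : dimH (Metric.sphere (0 : Fin (n + 1) → ℝ) 1) ≤ n := by
  have hsub : Metric.sphere (0 : Fin (n + 1) → ℝ) 1 ⊆
      ⋃ (q : Fin (n + 1) × Bool), range fun x : Fin n → ℝ ↦
        (q.1.insertNth (if q.2 then 1 else -1) x : Fin (n + 1) → ℝ) := by
    intro x hx
    have hx1 : ‖x‖ = 1 := by simpa using hx
    obtain ⟨i, hi⟩ := Pi.exists_norm_apply_eq_norm x
    rw [hx1, Real.norm_eq_abs] at hi
    rw [mem_iUnion]
    rcases (abs_eq zero_le_one).1 hi with hi | hi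
    · refine ⟨(i, true), i.removeNth x, ?_⟩
      simp [← hi]
    · refine ⟨(i, false), i.removeNth x, ?_⟩
      simp [← hi]
  refine (dimH_mono hsub).trans ?_
  rw [dimH_iUnion]
  refine iSup_le fun q ↦ ?_
  have hL : LipschitzWith 1 fun x : Fin n → ℝ ↦
      (q.1.insertNth (if q.2 then 1 else -1) x : Fin (n + 1) → ℝ) := by
    refine LipschitzWith.of_dist_le_mul fun x y ↦ ?_
    rw [NNReal.coe_one, one_mul, dist_pi_le_iff dist_nonneg]
    intro i
    refine Fin.succAboveCases q.1 ?_ (fun i ↦ ?_) i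
    · simp
    · simpa using dist_le_pi_dist x y i
  exact hL.dimH_range_le.trans (Real.dimH_univ_pi_fin n).le

/-- A continuous map from a closed subset of the `n`-sphere to a space of dimension greater than
`n` can be approximated by a continuous map on the sphere whose image has dense complement. -/
theorem exists_approx_dense_compl_range {n : ℕ} {W : Type*} [NormedAddCommGroup W]
    [NormedSpace ℝ W] [FiniteDimensional ℝ W] (hW : n < Module.finrank ℝ W)
    {A : Set (Metric.sphere (0 : Fin (n + 1) → ℝ) 1)} (hA : IsClosed A)
    {g : Metric.sphere (0 : Fin (n + 1) → ℝ) 1 → W} (hg : ContinuousOn g A)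
    {ε : ℝ} (hε : 0 < ε) :
    ∃ G : C(Metric.sphere (0 : Fin (n + 1) → ℝ) 1, W),
      (∀ x ∈ A, dist (G x) (g x) < ε) ∧ Dense (range G)ᶜ := by
  have : TietzeExtension W := TietzeExtension.of_tvs ℝ
  have hcl : IsClosedEmbedding fun x : A ↦ ((x : Metric.sphere (0 : Fin (n + 1) → ℝ) 1) :
      Fin (n + 1) → ℝ) :=
    Metric.isClosed_sphere.isClosedEmbedding_subtypeVal.comp hA.isClosedEmbedding_subtypeVal
  obtain ⟨g', hg'⟩ := ContinuousMap.exists_extension hcl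
    ⟨A.domRestrict g, continuousOn_iff_continuous_domRestrict.1 hg⟩
  -- After a Tietze extension, approximate by a `C¹` map: it does not raise Hausdorff dimension, so
  -- the image of the sphere is too small to contain an open set.
  obtain ⟨G, hG, hGg, -⟩ := g'.continuous.exists_contDiff_approx 1 (ε := fun _ ↦ ε)
    continuous_const fun _ ↦ hε
  refine ⟨⟨fun x ↦ G x, hG.continuous.comp continuous_subtype_val⟩, fun x hx ↦ ?_, ?_⟩
  · have h1 : g' x = g x := DFunLike.congr_fun hg' ⟨x, hx⟩
    simpa [h1] using hGg x
  · have hr : range (fun x : Metric.sphere (0 : Fin (n + 1) → ℝ) 1 ↦ G x) =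
        G '' Metric.sphere (0 : Fin (n + 1) → ℝ) 1 := by
      rw [image_eq_range]
    change Dense (range fun x : Metric.sphere (0 : Fin (n + 1) → ℝ) 1 ↦ G x)ᶜ
    rw [hr]
    exact hG.contDiffOn.dense_compl_image_of_dimH_lt_finrank convex_univ (subset_univ _)
      ((dimH_sphere_pi_le n).trans_lt (by exact_mod_cast hW))

/-! ### Polyhedra and linear forms -/

section Polyhedron

variable {V : Type*} [NormedAddCommGroup V] [InnerProductSpace ℝ V] [FiniteDimensional ℝ V]

theorem isOpen_setOf_forall_dual_lt (T : Finset (Module.Dual ℝ V)) (c : Module.Dual ℝ V → ℝ) :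
    IsOpen {e : V | ∀ l ∈ T, l e < c l} := by
  simp only [ofPred_forall]
  exact isOpen_biInter_finset fun l _ ↦
    isOpen_lt l.continuous_of_finiteDimensional continuous_const

/-- At an interior point one can still move a little in a direction in which a given nonzero `l`
increases, so its inequality is strict there. -/
theorem interior_setOf_forall_dual_le {T : Finset (Module.Dual ℝ V)} (hT : ∀ l ∈ T, l ≠ 0)
    (c : Module.Dual ℝ V → ℝ) :
    interior {e : V | ∀ l ∈ T, l e ≤ c l} = {e : V | ∀ l ∈ T, l e < c l} := by
  refine subset_antisymm (fun x hx l hl ↦ ?_)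
    (interior_maximal (fun e he l hl ↦ (he l hl).le) (isOpen_setOf_forall_dual_lt T c))
  obtain ⟨v, hv⟩ : ∃ v, 0 < l v := by
    obtain ⟨v, hv⟩ : ∃ v, l v ≠ 0 := by
      by_contra! h
      exact hT l hl (LinearMap.ext h)
    rcases hv.lt_or_gt with h | h
    · exact ⟨-v, by simpa using h⟩
    · exact ⟨v, h⟩
  have hcont : Continuous fun t : ℝ ↦ x + t • v := by fun_prop
  have hmem : ∀ᶠ t in 𝓝 (0 : ℝ), x + t • v ∈ interior {e : V | ∀ l ∈ T, l e ≤ c l} :=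
    hcont.continuousAt.eventually_mem (isOpen_interior.mem_nhds (by simpa using hx))
  obtain ⟨t, ht, ht0⟩ := ((hmem.filter_mono nhdsWithin_le_nhds).and
    (self_mem_nhdsWithin : Ioi (0 : ℝ) ∈ 𝓝[>] 0)).exists
  have := interior_subset ht l hl
  rw [map_add, map_smul, smul_eq_mul] at this
  nlinarith [mul_pos (show (0 : ℝ) < t from ht0) hv]

/-- Gordan's alternative. -/
theorem exists_forall_dual_neg_of_zero_notMem_convexHull {T : Finset (Module.Dual ℝ V)}
    (h : (0 : Module.Dual ℝ V) ∉ convexHull ℝ (T : Set (Module.Dual ℝ V))) :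
    ∃ v : V, ∀ l ∈ T, l v < 0 := by
  -- The Riesz isomorphism moves the convex hull to `V`, where Hahn–Banach separates it from `0`.
  let e : Module.Dual ℝ V ≃ₗ[ℝ] V :=
    LinearMap.toContinuousLinearMap.trans (InnerProductSpace.toDual ℝ V).symm.toLinearEquiv
  have he : ∀ l v, inner ℝ (e l) v = l v := fun l v ↦ by simp [e]
  have h0 : (0 : V) ∉ convexHull ℝ (e '' (T : Set (Module.Dual ℝ V))) := by
    rw [← LinearEquiv.coe_coe, ← LinearMap.image_convexHull]
    rintro ⟨l, hl, hl0⟩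
    rw [LinearEquiv.coe_coe, LinearEquiv.map_eq_zero_iff] at hl0
    exact h (hl0 ▸ hl)
  have hcl : IsClosed (convexHull ℝ (e '' (T : Set (Module.Dual ℝ V)))) :=
    (T.finite_toSet.image e).isClosed_convexHull ℝ
  obtain ⟨f, u, hf0, hfu⟩ := geometric_hahn_banach_point_closed (convex_convexHull ℝ _) hcl h0
  refine ⟨-(InnerProductSpace.toDual ℝ V).symm f, fun l hl ↦ ?_⟩
  have h1 := hfu (e l) (subset_convexHull ℝ _ (mem_image_of_mem e hl))
  rw [map_zero] at hf0
  rw [map_neg, ← he, real_inner_comm, InnerProductSpace.toDual_symm_apply]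
  linarith

/-- If `0` is a convex combination of elements of `T`, but not of few of them, then `T` spans a
space of large dimension. -/
theorem IsTame.le_finrank_orthogonal_dualCoannihilator {m : ℕ} {Λ : Set (Module.Dual ℝ V)}
    (hm : IsTame m Λ) {T : Finset (Module.Dual ℝ V)} (hT : (T : Set (Module.Dual ℝ V)) ⊆ Λ)
    (h : (0 : Module.Dual ℝ V) ∈ convexHull ℝ (T : Set (Module.Dual ℝ V))) :
    m ≤ Module.finrank ℝ
      (Submodule.span ℝ (T : Set (Module.Dual ℝ V))).dualCoannihilatorᗮ := by
  set U := Submodule.span ℝ (T : Set (Module.Dual ℝ V))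
  have h1 := Subspace.finrank_add_finrank_dualCoannihilator_eq U
  have h2 := Submodule.finrank_add_finrank_orthogonal U.dualCoannihilator
  suffices m ≤ Module.finrank ℝ U by omega
  -- A smallest subset with `0` in its hull is affinely independent, and by tameness it has at least
  -- `m + 1` elements; its differences therefore span dimension at least `m` inside `U`.
  let S := Caratheodory.minCardFinsetOfMemConvexHull h
  have hST : (S : Set (Module.Dual ℝ V)) ⊆ T :=
    Caratheodory.minCardFinsetOfMemConvexHull_subseteq h
  have hS : m < S.card := by
    by_contra! hc
    exact hm S (hST.trans hT) hc (Caratheodory.mem_minCardFinsetOfMemConvexHull h)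
  have hind := Caratheodory.affineIndependent_minCardFinsetOfMemConvexHull h
  have hcard := hind.card_le_finrank_succ
  rw [Subtype.range_coe_subtype, Fintype.card_coe] at hcard
  have hle : Module.finrank ℝ (vectorSpan ℝ {x | x ∈ S}) ≤ Module.finrank ℝ U := by
    refine Submodule.finrank_mono ?_
    rw [vectorSpan_def, Submodule.span_le]
    rintro _ ⟨a, ha, b, hb, rfl⟩
    exact U.sub_mem (Submodule.subset_span (hST ha)) (Submodule.subset_span (hST hb))
  have : S.card ≤ Module.finrank ℝ (vectorSpan ℝ {x | x ∈ S}) + 1 := hcard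
  omega

/-- Radial projection of a polyhedron from an interior point `x₁` to the boundary: the point `v` is
moved to `x₁ + R v • (v - x₁)`. -/
theorem exists_radial_factor {T : Finset (Module.Dual ℝ V)} (hT : T.Nonempty)
    {c : Module.Dual ℝ V → ℝ} {x₁ : V} (hx₁ : ∀ l ∈ T, l x₁ < c l) :
    ∃ R : V → ℝ, ContinuousOn R {v | ∃ l ∈ T, 0 < l (v - x₁)} ∧
      (∀ v, (∃ l ∈ T, c l ≤ l v) → R v = 1) ∧
      ∀ v, (∃ l ∈ T, 0 < l (v - x₁)) → ∃ l ∈ T, c l ≤ l (x₁ + R v • (v - x₁)) := by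
  -- The gauge of the polyhedron about `x₁`: `ρ v < 1` exactly when all inequalities hold strictly
  -- at `v`. Thus `(min 1 (ρ v))⁻¹` is `1` outside the open polyhedron, and inside it stretches `v`
  -- to the boundary whenever `ρ v > 0`.
  let ρ : V → ℝ := fun v ↦ T.sup' hT fun l ↦ l (v - x₁) / (c l - l x₁)
  have hpos : ∀ l ∈ T, 0 < c l - l x₁ := fun l hl ↦ sub_pos.2 (hx₁ l hl)
  have hle : ∀ v, ∀ l ∈ T, l (v - x₁) / (c l - l x₁) ≤ ρ v := fun v l hl ↦
    Finset.le_sup' (fun l ↦ l (v - x₁) / (c l - l x₁)) hl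
  have hρpos : ∀ v, (∃ l ∈ T, 0 < l (v - x₁)) → 0 < ρ v := fun v ⟨l, hl, h⟩ ↦
    (div_pos h (hpos l hl)).trans_le (hle v l hl)
  have hρ : Continuous ρ := by
    refine Continuous.finset_sup'_apply hT fun l _ ↦ ?_
    have := l.continuous_of_finiteDimensional
    fun_prop
  refine ⟨fun v ↦ (min 1 (ρ v))⁻¹, ?_, ?_, ?_⟩
  · refine ContinuousOn.inv₀ (by fun_prop) fun v hv ↦ ?_
    exact (lt_min one_pos (hρpos v hv)).ne'
  · rintro v ⟨l, hl, h⟩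
    have h1 : 1 ≤ ρ v := by
      refine le_trans ?_ (hle v l hl)
      rw [one_le_div (hpos l hl), map_sub]
      linarith
    simp [h1]
  · intro v hv
    obtain ⟨l, hl, h⟩ := Finset.exists_mem_eq_sup' hT fun l ↦ l (v - x₁) / (c l - l x₁)
    refine ⟨l, hl, ?_⟩
    have h' : l (v - x₁) = ρ v * (c l - l x₁) := by
      rw [show ρ v = _ from h, div_mul_cancel₀ _ (hpos l hl).ne']
    have h0 := hρpos v hv
    have hmin : 0 < min 1 (ρ v) := lt_min one_pos h0
    have h1 : 1 ≤ (min 1 (ρ v))⁻¹ * ρ v := by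
      rw [inv_mul_eq_div, one_le_div hmin]
      exact min_le_right _ _
    rw [map_add, map_smul, smul_eq_mul, h', ← mul_assoc]
    nlinarith [hpos l hl]

end Polyhedron

/-! ### Pushing maps out of a polyhedron -/

/-- Move a map into `F ∪ E` inside `E`, keeping it fixed over `F`, where `E` is parametrised by
`τ : V → E`. -/
theorem ContinuousMap.exists_homotopic_of_move {X Y V : Type*} [TopologicalSpace X]
    [TopologicalSpace Y] [TopologicalSpace V] {F E : Set Y} (hF : IsClosed F) (hE : IsClosed E)
    {p : Y → V} {τ : V → Y} (hτ : Continuous τ) (hτp : ∀ y ∈ E, τ (p y) = y)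
    (f : C(X, Y)) (hf : ∀ x, f x ∈ F ∪ E) {γ : I × X → V}
    (hγ : ContinuousOn γ {z | f z.2 ∈ E}) (hγ0 : ∀ x, f x ∈ E → γ (0, x) = p (f x))
    (hγF : ∀ t x, f x ∈ E → f x ∈ F → γ (t, x) = p (f x)) :
    ∃ h : C(X, Y), f.Homotopic h ∧ (∀ x, f x ∈ E → h x = τ (γ (1, x))) ∧
      ∀ x, f x ∉ E → h x = f x := by
  classical
  -- The moving and the stationary homotopy live over closed sets that cover everything, and `hγF`
  -- makes them agree on the overlap.
  let H : I × X → Y := fun z ↦ if f z.2 ∈ E then τ (γ z) else f z.2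
  have hH : Continuous H := by
    have hcE : IsClosed {z : I × X | f z.2 ∈ E} := hE.preimage (by fun_prop)
    have hcF : IsClosed {z : I × X | f z.2 ∈ F} := hF.preimage (by fun_prop)
    have h1 : ContinuousOn H {z : I × X | f z.2 ∈ E} :=
      (hτ.comp_continuousOn hγ).congr fun z hz ↦ if_pos hz
    have h2 : ContinuousOn H {z : I × X | f z.2 ∈ F} := by
      refine (Continuous.continuousOn (f := fun z : I × X ↦ f z.2) (by fun_prop)).congr
        fun z hz ↦ ?_
      by_cases hzE : f z.2 ∈ E
      · simp only [H, if_pos hzE]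
        rw [hγF z.1 z.2 hzE hz, hτp _ hzE]
      · exact if_neg hzE
    rw [← continuousOn_univ]
    refine (h1.union_of_isClosed h2 hcE hcF).mono fun z _ ↦ (hf z.2).symm
  have h0 : ∀ x, H (0, x) = f x := by
    intro x
    by_cases hx : f x ∈ E
    · simp only [H, if_pos hx, hγ0 x hx, hτp _ hx]
    · exact if_neg hx
  refine ⟨⟨fun x ↦ H (1, x), by fun_prop⟩, ⟨⟨⟨H, hH⟩, h0, fun x ↦ rfl⟩⟩, fun x hx ↦ if_pos hx,
    fun x hx ↦ if_neg hx⟩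

section Gluing

variable {Y : Type*} [TopologicalSpace Y]
  {V : Type*} [NormedAddCommGroup V] [InnerProductSpace ℝ V] [FiniteDimensional ℝ V]
  {F E : Set Y} {p : Y → V} {τ : V → Y} {T : Finset (Module.Dual ℝ V)} {c : Module.Dual ℝ V → ℝ}

/-- A map into `F ∪ E` that avoids the translate of the recession cone with apex `x₁` is pushed into
`F` by radial projection from `x₁`. -/
theorem exists_homotopic_of_forall_exists_pos {X : Type*} [TopologicalSpace X]
    (hF : IsClosed F) (hE : IsClosed E) (hp : ContinuousOn p E)
    (hτ : Continuous τ) (hτp : ∀ y ∈ E, τ (p y) = y)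
    (hτF : ∀ v, τ v ∉ F ↔ ∀ l ∈ T, l v < c l) (hT : T.Nonempty)
    {x₁ : V} (hx₁ : ∀ l ∈ T, l x₁ < c l)
    (f : C(X, Y)) (hf : ∀ x, f x ∈ F ∪ E)
    (hfx : ∀ x, f x ∈ E → ∃ l ∈ T, 0 < l (p (f x) - x₁)) :
    ∃ h : C(X, Y), f.Homotopic h ∧ ∀ x, h x ∈ F := by
  obtain ⟨R, hR, hR1, hRc⟩ := exists_radial_factor hT hx₁
  have hτF' : ∀ v, τ v ∈ F ↔ ∃ l ∈ T, c l ≤ l v := fun v ↦ by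
    rw [← not_iff_not, hτF]; push Not; rfl
  let γ : I × X → V := fun z ↦
    x₁ + ((1 - (z.1 : ℝ)) + z.1 * R (p (f z.2))) • (p (f z.2) - x₁)
  have hpf : ContinuousOn (fun z : I × X ↦ p (f z.2)) {z | f z.2 ∈ E} :=
    hp.comp (by fun_prop) fun z hz ↦ hz
  have hRf : ContinuousOn (fun z : I × X ↦ R (p (f z.2))) {z | f z.2 ∈ E} :=
    hR.comp hpf fun z hz ↦ hfx _ hz
  have hI : ContinuousOn (fun z : I × X ↦ (z.1 : ℝ)) {z | f z.2 ∈ E} := by fun_prop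
  have hγ : ContinuousOn γ {z | f z.2 ∈ E} :=
    continuousOn_const.add
      (((continuousOn_const.sub hI).add (hI.mul hRf)).smul (hpf.sub continuousOn_const))
  obtain ⟨h, hh, hhE, hhF⟩ := ContinuousMap.exists_homotopic_of_move hF hE hτ hτp f hf hγ
    (fun x _ ↦ by simp [γ]) (fun t x hxE hxF ↦ by
      have : R (p (f x)) = 1 := hR1 _ ((hτF' _).1 (by rwa [hτp _ hxE]))
      simp [γ, this])
  refine ⟨h, hh, fun x ↦ ?_⟩
  by_cases hx : f x ∈ E
  · rw [hhE x hx, hτF']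
    simpa [γ] using hRc _ (hfx x hx)
  · rw [hhF x hx]
    exact (hf x).resolve_right hx

/-- If the recession cone of the polyhedron is not a linear subspace, maps from compact spaces can be
pushed out of the polyhedron. -/
theorem exists_homotopic_of_recession {X : Type*} [TopologicalSpace X] [CompactSpace X]
    (hF : IsClosed F) (hE : IsClosed E) (hp : ContinuousOn p E)
    (hτ : Continuous τ) (hτp : ∀ y ∈ E, τ (p y) = y)
    (hτF : ∀ v, τ v ∉ F ↔ ∀ l ∈ T, l v < c l)
    {x₀ : V} (hx₀ : ∀ l ∈ T, l x₀ < c l)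
    {v : V} (hv : ∀ l ∈ T, l v ≤ 0) {l : Module.Dual ℝ V} (hl : l ∈ T) (hlv : l v < 0)
    (f : C(X, Y)) (hf : ∀ x, f x ∈ F ∪ E) :
    ∃ h : C(X, Y), f.Homotopic h ∧ ∀ x, h x ∈ F := by
  have hpf : ContinuousOn (fun x ↦ l (p (f x))) {x | f x ∈ E} :=
    l.continuous_of_finiteDimensional.comp_continuousOn (hp.comp (by fun_prop) fun x hx ↦ hx)
  have hcpt : IsCompact {x | f x ∈ E} := (hE.preimage f.continuous).isCompact
  obtain ⟨M, hM⟩ := (hcpt.image_of_continuousOn hpf).bddBelow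
  -- Chosen so that `l (x₀ + n • v) < M`, which is at most every value of `l ∘ p ∘ f` over `E`;
  -- since `v` is a recession direction, `x₀ + n • v` stays in the open polyhedron.
  obtain ⟨n, hn⟩ := exists_nat_gt ((l x₀ - M) / -l v)
  rw [div_lt_iff₀ (by linarith)] at hn
  refine exists_homotopic_of_forall_exists_pos hF hE hp hτ hτp hτF ⟨l, hl⟩ (x₁ := x₀ + (n : ℝ) • v)
    (fun l' hl' ↦ ?_) f hf fun x hx ↦ ⟨l, hl, ?_⟩
  · rw [map_add, map_smul, smul_eq_mul]
    nlinarith [hx₀ l' hl', hv l' hl', (Nat.cast_nonneg n : (0 : ℝ) ≤ n)]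
  · have := hM ⟨x, hx, rfl⟩
    simp only [map_sub, map_add, map_smul, smul_eq_mul] at this ⊢
    linarith

/-- If the polyhedron is the product of a subspace and a polytope of dimension greater than `k`, maps
from the `k`-sphere can be pushed out of it. -/
theorem exists_homotopic_of_lt_finrank {k : ℕ}
    (hF : IsClosed F) (hE : IsClosed E) (hp : ContinuousOn p E)
    (hτ : Continuous τ) (hτE : ∀ v, τ v ∈ E) (hpτ : ∀ v, p (τ v) = v) (hτp : ∀ y ∈ E, τ (p y) = y)
    (hτF : ∀ v, τ v ∉ F ↔ ∀ l ∈ T, l v < c l) (hT : T.Nonempty)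
    {x₀ : V} (hx₀ : ∀ l ∈ T, l x₀ < c l) {C : Submodule ℝ V}
    (hC : ∀ v ∈ C, ∀ l ∈ T, l v = 0) (hC' : ∀ v, (∀ l ∈ T, l v ≤ 0) → v ∈ C)
    (hk : k < Module.finrank ℝ Cᗮ)
    (f : C(Metric.sphere (0 : Fin (k + 1) → ℝ) 1, Y)) (hf : ∀ x, f x ∈ F ∪ E) :
    ∃ h : C(Metric.sphere (0 : Fin (k + 1) → ℝ) 1, Y), f.Homotopic h ∧ ∀ x, h x ∈ F := by
  let q : V →L[ℝ] Cᗮ := Cᗮ.orthogonalProjectionOnto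
  have hq : ∀ w : Cᗮ, q w = w := fun w ↦ Submodule.orthogonalProjectionOnto_mem_subspace_eq_self w
  have hlq : ∀ v, ∀ l ∈ T, l (q v) = l v := by
    intro v l hl
    have h1 : v - q v ∈ C := by
      have := Submodule.sub_starProjection_mem_orthogonal (K := Cᗮ) v
      rwa [Submodule.orthogonal_orthogonal] at this
    have := hC _ h1 l hl
    rw [map_sub] at this
    linarith
  have hqC : ∀ v ∈ C, q v = 0 := fun v hv ↦
    Submodule.orthogonalProjectionOnto_eq_zero_iff.2
      (by rwa [Submodule.orthogonal_orthogonal])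
  obtain ⟨δ, hδ, hball⟩ := Metric.isOpen_iff.1 (isOpen_setOf_forall_dual_lt T c) (q x₀ : V)
    (fun l hl ↦ by rw [hlq _ l hl]; exact hx₀ l hl)
  -- Everything whose projection is within `2 * ε` of `q x₀` lies in the open polyhedron, so a
  -- perturbation supported there does not touch `F`.
  obtain ⟨ε, hε, hεδ⟩ : ∃ ε, 0 < ε ∧ 2 * ε < δ := ⟨δ / 3, by linarith, by linarith⟩
  have hin : ∀ v, dist (q v) (q x₀) ≤ 2 * ε → ∀ l ∈ T, l v < c l := by
    intro v hv l hl
    rw [← hlq v l hl]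
    exact hball (show (q v : V) ∈ Metric.ball (q x₀ : V) δ from hv.trans_lt hεδ) l hl
  have hpf : ContinuousOn (fun x ↦ p (f x)) {x | f x ∈ E} := hp.comp (by fun_prop) fun x hx ↦ hx
  have hg : ContinuousOn (fun x ↦ q (p (f x))) {x | f x ∈ E} := q.continuous.comp_continuousOn hpf
  have hA : IsClosed ({x | f x ∈ E} ∩ (fun x ↦ q (p (f x))) ⁻¹' Metric.closedBall (q x₀) (2 * ε)) :=
    hg.preimage_isClosed_of_isClosed (hE.preimage f.continuous) Metric.isClosed_closedBall
  obtain ⟨G, hGg, hGd⟩ := exists_approx_dense_compl_range hk hA (hg.mono inter_subset_left)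
    (half_pos hε)
  -- The future centre of projection: a point near `q x₀` missed by the approximation `G`.
  obtain ⟨z, hzG, hz⟩ := hGd.exists_dist_lt (q x₀) (half_pos hε)
  -- A cutoff, equal to `1` within `ε` of `q x₀` and to `0` beyond `2 * ε`. The path `γ` replaces
  -- the projection `w` by `G x` in the inner ball and interpolates in between.
  let b : Cᗮ → ℝ := fun w ↦ max 0 (min 1 (2 - dist w (q x₀) / ε))
  have hb : Continuous b := by fun_prop
  have hb0 : ∀ w, 2 * ε ≤ dist w (q x₀) → b w = 0 := by
    intro w hw
    have : 2 - dist w (q x₀) / ε ≤ 0 := by rw [sub_nonpos, le_div_iff₀ hε]; exact hw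
    exact max_eq_left ((min_le_right _ _).trans this)
  have hb1 : ∀ w, dist w (q x₀) ≤ ε → b w = 1 := by
    intro w hw
    have : 1 ≤ 2 - dist w (q x₀) / ε := by
      have := (div_le_one hε).2 hw
      linarith
    simp [b, this]
  have hbI : ∀ w, 0 ≤ b w ∧ b w ≤ 1 := fun w ↦
    ⟨le_max_left _ _, max_le zero_le_one (min_le_left _ _)⟩
  let γ : I × Metric.sphere (0 : Fin (k + 1) → ℝ) 1 → V := fun s ↦
    p (f s.2) + ((s.1 : ℝ) * b (q (p (f s.2)))) • ((G s.2 - q (p (f s.2)) : Cᗮ) : V)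
  have hγ : ContinuousOn γ {s | f s.2 ∈ E} := by
    have h1 : ContinuousOn (fun s : I × Metric.sphere (0 : Fin (k + 1) → ℝ) 1 ↦ p (f s.2))
      {s | f s.2 ∈ E} := hp.comp (by fun_prop) fun z hz ↦ hz
    have h2 : ContinuousOn (fun s : I × Metric.sphere (0 : Fin (k + 1) → ℝ) 1 ↦ (s.1 : ℝ))
      {s | f s.2 ∈ E} := by fun_prop
    have h3 := q.continuous.comp_continuousOn h1
    exact h1.add ((h2.mul (hb.comp_continuousOn h3)).smul (continuous_subtype_val.comp_continuousOn
      ((G.continuous.comp continuous_snd).continuousOn.sub h3)))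
  obtain ⟨h, hh, hhE, hhF⟩ := ContinuousMap.exists_homotopic_of_move hF hE hτ hτp f hf hγ
    (fun x _ ↦ by simp [γ]) (fun t x hxE hxF ↦ by
      have : b (q (p (f x))) = 0 := by
        refine hb0 _ ?_
        by_contra! hlt
        refine (hτF (p (f x))).2 (hin _ hlt.le) ?_
        rwa [hτp _ hxE]
      simp [γ, this])
  have hhFE : ∀ x, h x ∈ F ∪ E := by
    intro x
    by_cases hx : f x ∈ E
    · rw [hhE x hx]; exact Or.inr (hτE _)
    · rw [hhF x hx]; exact hf x
  obtain ⟨h', hh', hF'⟩ := exists_homotopic_of_forall_exists_pos hF hE hp hτ hτp hτF hT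
    (x₁ := (z : V)) (fun l hl ↦ by
      refine hball (show (z : V) ∈ Metric.ball (q x₀ : V) δ from ?_) l hl
      rw [Metric.mem_ball, dist_comm]
      exact lt_trans hz (by linarith)) h hhFE (fun x hx ↦ by
    have hxE : f x ∈ E := by
      by_contra hxE
      exact hxE (hhF x hxE ▸ hx)
    -- Otherwise `p (h x) - z` lies in `C`, so the perturbed projection equals `z`. In the inner
    -- ball it is `G x`, which is never `z`; further out it has moved by at most `ε / 2`, too little
    -- to reach `z`, which is within `ε / 2` of `q x₀`.
    by_contra! hcon
    have h1 := hqC _ (hC' _ hcon)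
    rw [map_sub, hq, sub_eq_zero, hhE x hxE, hpτ] at h1
    have h2 : q (p (f x)) + b (q (p (f x))) • (G x - q (p (f x))) = z := by
      simpa only [γ, map_add, map_smul, hq, Set.Icc.coe_one, one_mul] using h1
    set w := q (p (f x)) with hw
    rcases le_or_gt (dist w (q x₀)) ε with hle | hgt
    · rw [hb1 w hle, one_smul, add_sub_cancel] at h2
      exact hzG ⟨x, h2⟩
    · have h3 : dist z w ≤ ε / 2 := by
        rw [← h2, dist_eq_norm, add_sub_cancel_left, norm_smul, Real.norm_of_nonneg (hbI w).1]
        rcases le_or_gt (dist w (q x₀)) (2 * ε) with h5 | h5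
        · have := (hGg x ⟨hxE, h5⟩).le
          rw [dist_eq_norm] at this
          calc b w * ‖G x - w‖ ≤ 1 * ‖G x - w‖ := by gcongr; exact (hbI w).2
            _ ≤ ε / 2 := by rw [one_mul]; exact this
        · rw [hb0 w h5.le, zero_mul]; positivity
      have h4 := dist_triangle w z (q x₀)
      rw [dist_comm w z, dist_comm z (q x₀)] at h4
      linarith)
  exact ⟨h', hh.trans hh', hF'⟩

/-- Gluing in a polyhedron cut out by an `m`-tame set of linear forms does not create new homotopy
classes of maps from the `k`-sphere, for `k < m`. -/
theorem IsTame.exists_homotopic {m k : ℕ} {Λ : Set (Module.Dual ℝ V)} (hm : IsTame m Λ)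
    (hTΛ : (T : Set (Module.Dual ℝ V)) ⊆ Λ) (hkm : k < m)
    (hF : IsClosed F) (hE : IsClosed E) (hp : ContinuousOn p E)
    (hτ : Continuous τ) (hτE : ∀ v, τ v ∈ E) (hpτ : ∀ v, p (τ v) = v) (hτp : ∀ y ∈ E, τ (p y) = y)
    (hτF : ∀ v, τ v ∉ F ↔ ∀ l ∈ T, l v < c l) (hT : T.Nonempty)
    (f : C(Metric.sphere (0 : Fin (k + 1) → ℝ) 1, Y)) (hf : ∀ x, f x ∈ F ∪ E) :
    ∃ h : C(Metric.sphere (0 : Fin (k + 1) → ℝ) 1, Y), f.Homotopic h ∧ ∀ x, h x ∈ F := by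
  by_cases hne : ∃ x₀, ∀ l ∈ T, l x₀ < c l
  · obtain ⟨x₀, hx₀⟩ := hne
    by_cases hrec : ∃ v, (∀ l ∈ T, l v ≤ 0) ∧ ∃ l ∈ T, l v < 0
    · obtain ⟨v, hv, l, hl, hlv⟩ := hrec
      exact exists_homotopic_of_recession hF hE hp hτ hτp hτF hx₀ hv hl hlv f hf
    -- Now every recession direction is killed by all of `T`. A `v` with all `l v < 0` is thus
    -- impossible, so Gordan puts `0` in the convex hull.
    · push Not at hrec
      have h0 : (0 : Module.Dual ℝ V) ∈ convexHull ℝ (T : Set (Module.Dual ℝ V)) := by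
        by_contra h0
        obtain ⟨v, hv⟩ := exists_forall_dual_neg_of_zero_notMem_convexHull h0
        obtain ⟨l, hl⟩ := hT
        exact (hv l hl).not_ge (hrec v (fun l hl ↦ (hv l hl).le) l hl)
      refine exists_homotopic_of_lt_finrank hF hE hp hτ hτE hpτ hτp hτF hT hx₀
        (C := (Submodule.span ℝ (T : Set (Module.Dual ℝ V))).dualCoannihilator)
        (fun v hv l hl ↦ ?_) (fun v hv ↦ ?_)
        (hkm.trans_le (hm.le_finrank_orthogonal_dualCoannihilator hTΛ h0)) f hf
      · exact (Submodule.mem_dualCoannihilator v).1 hv l (Submodule.subset_span hl)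
      · rw [Submodule.mem_dualCoannihilator]
        intro φ hφ
        have : Submodule.span ℝ (T : Set (Module.Dual ℝ V)) ≤
            LinearMap.ker (Module.Dual.eval ℝ V v) :=
          Submodule.span_le.2 fun l hl ↦ le_antisymm (hv l hl) (hrec v hv l hl)
        exact this hφ
  -- If the strict inequalities have no solution, then `E` is contained in `F`.
  · refine ⟨f, .refl f, fun x ↦ (hf x).elim id fun hx ↦ ?_⟩
    by_contra hxF
    rw [← hτp _ hx, hτF] at hxF
    exact hne ⟨_, hxF⟩

end Gluing

/-! ### Induction along the increasing sequence -/

section LambdaComplex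

variable {Y : Type*} [TopologicalSpace Y] [CWComplex (univ : Set Y)]
  {D : PiecewiseEuclidean Y} {V : Type*} [NormedAddCommGroup V]

theorem IsIsometryOnto.exists_homeomorph {p : Y → V} {S : Set Y} (h : IsIsometryOnto D p S) :
    ∃ e : S ≃ₜ V, ∀ y, e y = p y :=
  ⟨h.isHomeomorph.homeomorph, fun _ ↦ rfl⟩

variable [InnerProductSpace ℝ V] [FiniteDimensional ℝ V]
  {p : Y → V} {Λ : Set (Module.Dual ℝ V)} {N : ℕ∞} {E : ℕ → RelCWComplex.Subcomplex (univ : Set Y)}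

/-- Maps from low-dimensional spheres into the first `j + 1` members of the sequence can be deformed
into the first `j` members. -/
theorem IsIncreasingSequence.exists_homotopic {m k : ℕ} (h : IsIncreasingSequence D p Λ N E)
    (hΛ : Λ.Finite) (hm : IsTame m Λ) (hkm : k < m) {j : ℕ} (hj : 0 < j) (hjN : (j : ℕ∞) < N)
    (f : C(Metric.sphere (0 : Fin (k + 1) → ℝ) 1, Y)) (hf : ∀ x, ∃ i ≤ j, f x ∈ E i) :
    ∃ g : C(Metric.sphere (0 : Fin (k + 1) → ℝ) 1, Y), f.Homotopic g ∧ ∀ x, ∃ i < j, g x ∈ E i := by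
  obtain ⟨e, he⟩ := (h.isometry j hjN).exists_homeomorph
  obtain ⟨K, c, hKE, ⟨lam, hlam, hclam⟩, hpK, hnew⟩ := h.newPart j hj hjN
  -- Only the forms with a finite bound cut out the polyhedron, so the default in `untopD 0` is
  -- never taken on `T`.
  let T : Finset (Module.Dual ℝ V) := (hΛ.subset (sep_subset Λ fun l ↦ c l ≠ ⊤)).toFinset
  have hT : ∀ l, l ∈ T ↔ l ∈ Λ ∧ c l ≠ ⊤ := fun l ↦ by simp [T]
  have hT0 : ∀ l ∈ T, l ≠ 0 := by
    rintro l hl rfl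
    -- Since `k < m` forces `m ≥ 1`, tameness excludes the zero form.
    refine hm {0} (by simpa using ((hT 0).1 hl).1) (by rw [Finset.card_singleton]; omega) ?_
    simp
  have hP : p '' (K : Set Y) = {v | ∀ l ∈ T, l v ≤ (c l).untopD 0} := by
    rw [hpK]
    ext v
    refine forall_congr' fun l ↦ ?_
    rw [hT]
    rcases eq_or_ne (c l) ⊤ with hc | hc
    · simp [hc]
    · obtain ⟨r, hr⟩ := WithTop.ne_top_iff_exists.1 hc
      simp [← hr]
  have hKint : e '' interior {y : (E j : Set Y) | (y : Y) ∈ (K : Set Y)} =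
      {v | ∀ l ∈ T, l v < (c l).untopD 0} := by
    rw [e.image_interior, ← interior_setOf_forall_dual_le hT0, ← hP]
    congr 1
    ext v
    constructor
    · rintro ⟨y, hy, rfl⟩
      exact ⟨y, hy, (he y).symm⟩
    · rintro ⟨y, hy, rfl⟩
      exact ⟨⟨y, hKE hy⟩, hy, he _⟩
  have hclosed : ∀ i, IsClosed (E i : Set Y) := fun i ↦ RelCWComplex.Subcomplex.closed (E i)
  have hF : IsClosed (⋃ i < j, (E i : Set Y)) :=
    (finite_Iio j).isClosed_biUnion fun i _ ↦ hclosed i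
  have hτp : ∀ y ∈ (E j : Set Y), (e.symm (p y) : Y) = y := fun y hy ↦ by
    rw [← he ⟨y, hy⟩, e.symm_apply_apply]
  -- The homeomorphism `e` carries the relative interior of `K` to the interior of its image, which
  -- is the set of strict inequalities.
  have hτF : ∀ v, (e.symm v : Y) ∉ ⋃ i < j, (E i : Set Y) ↔ ∀ l ∈ T, l v < (c l).untopD 0 := by
    intro v
    have h1 : (e.symm v : Y) ∉ ⋃ i < j, (E i : Set Y) ↔
        (e.symm v : Y) ∈ (E j : Set Y) \ ⋃ i < j, (E i : Set Y) :=
      ⟨fun h ↦ ⟨(e.symm v).2, h⟩, fun h ↦ h.2⟩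
    rw [h1, hnew, Subtype.val_injective.mem_set_image]
    change _ ↔ v ∈ {v | ∀ l ∈ T, l v < (c l).untopD 0}
    rw [← hKint, e.image_eq_preimage_symm]
    rfl
  have hp : ContinuousOn p (E j : Set Y) := by
    rw [continuousOn_iff_continuous_domRestrict]
    exact e.continuous.congr he
  obtain ⟨g, hg, hgF⟩ := hm.exists_homotopic (fun l hl ↦ ((hT l).1 hl).1) hkm hF (hclosed j) hp
    (continuous_subtype_val.comp e.symm.continuous) (fun v ↦ (e.symm v).2)
    (fun v ↦ by rw [Function.comp_apply, ← he, e.apply_symm_apply]) hτp hτF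
    ⟨lam, (hT lam).2 ⟨hlam, hclam⟩⟩ f (fun x ↦ by
      obtain ⟨i, hi, hx⟩ := hf x
      rcases hi.lt_or_eq with hi | rfl
      · exact Or.inl (mem_iUnion₂.2 ⟨i, hi, hx⟩)
      · exact Or.inr hx)
  refine ⟨g, hg, fun x ↦ ?_⟩
  obtain ⟨i, hi, hx⟩ := mem_iUnion₂.1 (hgF x)
  exact ⟨i, hi, hx⟩

/-- Members are removed one at a time, from the last down to the contractible `E 0`. -/
theorem IsIncreasingSequence.nullhomotopic {m k : ℕ} (h : IsIncreasingSequence D p Λ N E)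
    (hΛ : Λ.Finite) (hm : IsTame m Λ) (hkm : k < m) (j : ℕ)
    (f : C(Metric.sphere (0 : Fin (k + 1) → ℝ) 1, Y))
    (hf : ∀ x, ∃ i ≤ j, (i : ℕ∞) < N ∧ f x ∈ E i) : f.Nullhomotopic := by
  induction j generalizing f with
  | zero =>
    obtain ⟨e, -⟩ := (h.isometry 0 h.pos).exists_homeomorph
    have hf0 : ∀ x, f x ∈ (E 0 : Set Y) := fun x ↦ by
      obtain ⟨i, hi, -, hx⟩ := hf x
      rwa [Nat.le_zero.1 hi] at hx
    have : ContractibleSpace (E 0 : Set Y) := e.contractibleSpace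
    let f' : C(Metric.sphere (0 : Fin (k + 1) → ℝ) 1, (E 0 : Set Y)) :=
      ⟨fun x ↦ ⟨f x, hf0 x⟩, by fun_prop⟩
    have hf' : f'.Nullhomotopic :=
      (id_nullhomotopic (E 0 : Set Y)).comp_left f'
    exact hf'.comp_right ⟨Subtype.val, continuous_subtype_val⟩
  | succ j ih =>
    by_cases hj : ((j + 1 : ℕ) : ℕ∞) < N
    · obtain ⟨g, hg, hgE⟩ := h.exists_homotopic hΛ hm hkm j.succ_pos hj f fun x ↦ by
        obtain ⟨i, hi, -, hx⟩ := hf x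
        exact ⟨i, hi, hx⟩
      obtain ⟨y, hy⟩ := ih g fun x ↦ by
        obtain ⟨i, hi, hx⟩ := hgE x
        exact ⟨i, Nat.lt_succ_iff.1 hi, lt_trans (Nat.cast_lt.2 hi) hj, hx⟩
      exact ⟨y, hg.trans hy⟩
    -- The sequence has already ended before `j + 1`, so there is nothing to remove.
    · refine ih f fun x ↦ ?_
      obtain ⟨i, hi, hiN, hx⟩ := hf x
      refine ⟨i, Nat.lt_succ_iff.1 (lt_of_le_of_ne hi ?_), hiN, hx⟩
      rintro rfl
      exact hj hiN

end LambdaComplex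

theorem proposition4p11 {Y : Type*} [TopologicalSpace Y] [T2Space Y] [CWComplex (univ : Set Y)]
    (D : PiecewiseEuclidean Y)
    {V : Type*} [NormedAddCommGroup V] [InnerProductSpace ℝ V] [FiniteDimensional ℝ V]
    (p : Y → V) (Λ : Set (Module.Dual ℝ V)) (m : ℕ)
    (hY : IsLambdaComplex D p Λ) (hm : IsTame m Λ) :
    IsNConnected ((m : ℤ) - 1) Y := by
  obtain ⟨hΛ, N, E, h⟩ := hY
  refine ⟨?_, fun k hk y ↦ ?_⟩
  · obtain ⟨e, -⟩ := (h.isometry 0 h.pos).exists_homeomorph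
    exact ⟨e.symm 0⟩
  · refine HomotopyGroup.subsingleton_pi_of_nullhomotopic (fun f ↦ ?_) y
    obtain ⟨J, hJ⟩ := CWComplex.isCompact_subset_iUnion_subcomplex (P := fun j : ℕ ↦ (j : ℕ∞) < N)
      h.cover (isCompact_range f.continuous)
    exact h.nullhomotopic hΛ hm (by omega) J f fun x ↦ hJ _ (mem_range_self x)
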